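/- A principal and an agent interact repeatedly. The agent has a finite non-empty action set $A$ and a utility function $v:\mathcal X\times A\to\mathbb R$ with $|v|\le B$, where $\mathcal X$ is the principal's decision space, and $S$ is a finite set of signals (contexts). In round $t=1,2,\dots$ the agent's learning algorithm chooses, from its past signals, actions and obtained utilities (bandit feedback), a strategy $\rho^t:S\to\Delta(A)$; the principal then chooses, depending arbitrarily on the whole history and on $\rho^t$, a (discrete) joint distribution of a signal $s^t\in S$ and a decision $x^t\in\mathcal X$ (for instance a distribution over signals and one decision $x^t_s$ per signal), from which $(s^t,x^t)$ is drawn; the agent draws $a^t\sim\rho^t(s^t)$ and obtains and observes $v(x^t,a^t)$. The algorithm has contextual regret at most $\mathrm{CReg}(T)$ if for every strategy of the principal, every $T$ and every $d:S\to A$, $$\mathbb E\Big[\sum_{t=1}^T\big(v(x^t,d(s^t))-v(x^t,a^t)\big)\Big]\le \mathrm{CReg}(T),$$ and contextual swap-regret at most $\mathrm{CSReg}(T)$ if for every strategy of the principal, every $T$ and every $d:S\times A\to A$, $$\mathbb E\Big[\sum_{t=1}^T\big(v(x^t,d(s^t,a^t))-v(x^t,a^t)\big)\Big]\le \mathrm{CSReg}(T).$$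 An ordinary multi-armed bandit algorithm for arm set $A$ chooses each action at random depending on its own past actions and obtained rewards; its regret (respectively swap-regret) is at most $R(T)$ if, against every adaptive adversary that chooses reward vectors $r^t\in[-B,B]^A$ depending on the past (and possibly at random), for every $T$ and every $b\in A$ (respectively every $d:A\to A$), $\mathbb E[\sum_{t\le T}(r^t(b)-r^t(a^t))]\le R(T)$ (respectively $\mathbb E[\sum_{t\le T}(r^t(d(a^t))-r^t(a^t))]\le R(T)$). **Proposition.** There is an absolute constant $C>0$ such that for every finite non-empty $A$ and every $B\ge 0$ the following hold. 1. There is an ordinary bandit algorithm for $A$ with regret at most $C B\sqrt{|A|\,T}$ such that, for every finite $S$, every $\mathcal X$ and every $v:\mathcal X\times A\to[-B,B]$, the contextual algorithm that runs an independent copy of it for each context has contextual regret $\mathrm{CReg}(T)\le C B\sqrt{|A|\,|S|\,T}$. 2. There is an ordinary bandit algorithm for $A$ with swap-regret at most $C B\,|A|\sqrt{T}$ such that, for every finite $S$, every $\mathcal X$ and every $v:\mathcal X\times A\to[-B,B]$, the contextual algorithm that runs an independent copy of it for each context has contextual swap-regret $\mathrm{CSReg}(T)\le C B\,|A|\sqrt{|S|\,T}$.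 -/

import Mathlib

/-- The expectation of a real function `f` under the discrete distribution `p`. -/
noncomputable def PMF.expect {α : Type*} (p : PMF α) (f : α → ℝ) : ℝ :=
  ∑' x, (p x).toReal * f x

/-! ### Contextual bandits against an adaptive principal

Histories are lists of completed rounds, the most recent round first. -/

/-- A completed round: the signal `s^t`, the principal's decision `x^t`, the agent's
action `a^t`. -/
structure Round (S X A : Type*) where
  signal : S
  decision : X
  action : A

/-- A learning algorithm of the agent under bandit feedback. The algorithm sees, for each past
round, the signal, its own action and the utility it obtained; from this it chooses the strategy
`ρ^t : S → Δ(A)` of the next round. -/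
abbrev ContextualAlgorithm (S A : Type*) := List (S × A × ℝ) → S → PMF A

/-- An adaptive strategy of the principal. After each history (signals, decisions and actions of
all past rounds) it gives the joint distribution of the next signal and decision. The agent's
`ρ^t` is a function of the past, so the principal may react to `ρ^t`. A distribution over
signals together with one decision `x_s` for each signal `s` is the special case
`π.map fun s => (s, x s)` for `π : PMF S`. -/
abbrev PrincipalStrategy (S X A : Type*) := List (Round S X A) → PMF (S × X)

/-- What the agent has observed after a history, if its utility function is `v`. -/
def agentView {S X A : Type*} (v : X → A → ℝ) (h : List (Round S X A)) : List (S × A × ℝ) :=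
  h.map fun r => (r.signal, r.action, v r.decision r.action)

/-- The law of the history of the first `T` rounds: in each round signal and decision are drawn
from the principal's strategy, then the action is drawn from `ρ^t(s^t)`. -/
noncomputable def gameLaw {S X A : Type*} (v : X → A → ℝ) (alg : ContextualAlgorithm S A)
    (σ : PrincipalStrategy S X A) : ℕ → PMF (List (Round S X A))
  | 0 => PMF.pure []
  | T + 1 =>
    (gameLaw v alg σ T).bind fun h =>
      (σ h).bind fun q =>
        (alg (agentView v h) q.1).map fun a => ⟨q.1, q.2, a⟩ :: h

/-- The contextual regret of `alg` is at most `R`: against every strategy of the principal, for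
every number of rounds and every deviation `d : S → A`. -/
def ContextualRegretLE {S X A : Type*} (v : X → A → ℝ) (alg : ContextualAlgorithm S A)
    (R : ℕ → ℝ) : Prop :=
  ∀ (σ : PrincipalStrategy S X A) (T : ℕ) (d : S → A),
    (gameLaw v alg σ T).expect (fun h =>
      (h.map fun r => v r.decision (d r.signal) - v r.decision r.action).sum) ≤ R T

/-- The contextual swap-regret of `alg` is at most `R`: against every strategy of the principal,
for every number of rounds and every deviation `d : S × A → A`. -/
def ContextualSwapRegretLE {S X A : Type*} (v : X → A → ℝ) (alg : ContextualAlgorithm S A)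
    (R : ℕ → ℝ) : Prop :=
  ∀ (σ : PrincipalStrategy S X A) (T : ℕ) (d : S × A → A),
    (gameLaw v alg σ T).expect (fun h =>
      (h.map fun r => v r.decision (d (r.signal, r.action)) - v r.decision r.action).sum) ≤ R T

/-! ### Ordinary multi-armed bandits -/

/-- An ordinary bandit algorithm: from its past actions and obtained rewards it chooses the
distribution of the next action. -/
abbrev BanditAlgorithm (A : Type*) := List (A × ℝ) → PMF A

/-- An adaptive bandit adversary: from the past reward vectors and actions it chooses the
(possibly random) next reward vector. -/
abbrev BanditAdversary (A : Type*) := List ((A → ℝ) × A) → PMF (A → ℝ)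

/-- All reward vectors that the adversary may choose have entries in `[-B, B]`. -/
def BanditAdversary.BoundedBy {A : Type*} (adv : BanditAdversary A) (B : ℝ) : Prop :=
  ∀ h, ∀ r ∈ (adv h).support, ∀ a, |r a| ≤ B

/-- The law of the first `T` rounds (reward vector and action) of the bandit game. -/
noncomputable def banditLaw {A : Type*} (alg : BanditAlgorithm A) (adv : BanditAdversary A) :
    ℕ → PMF (List ((A → ℝ) × A))
  | 0 => PMF.pure []
  | T + 1 =>
    (banditLaw alg adv T).bind fun h =>
      (adv h).bind fun r =>
        (alg (h.map fun z => (z.2, z.1 z.2))).map fun a => (r, a) :: h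

/-- The (external) regret of `alg` for rewards in `[-B, B]` is at most `R`. -/
def BanditRegretLE {A : Type*} (B : ℝ) (alg : BanditAlgorithm A) (R : ℕ → ℝ) : Prop :=
  ∀ adv : BanditAdversary A, adv.BoundedBy B → ∀ (T : ℕ) (b : A),
    (banditLaw alg adv T).expect (fun h => (h.map fun z => z.1 b - z.1 z.2).sum) ≤ R T

/-- The swap-regret of `alg` for rewards in `[-B, B]` is at most `R`. -/
def BanditSwapRegretLE {A : Type*} (B : ℝ) (alg : BanditAlgorithm A) (R : ℕ → ℝ) : Prop :=
  ∀ adv : BanditAdversary A, adv.BoundedBy B → ∀ (T : ℕ) (d : A → A),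
    (banditLaw alg adv T).expect (fun h => (h.map fun z => z.1 (d z.2) - z.1 z.2).sum) ≤ R T

/-- Run an independent copy of a bandit algorithm for each context: on signal `s`, the action is
drawn from the algorithm applied to the past rounds with signal `s` only. -/
def perContext {A : Type*} (alg : BanditAlgorithm A) (S : Type*) [DecidableEq S] :
    ContextualAlgorithm S A :=
  fun h s => alg ((h.filter fun z => z.1 = s).map fun z => z.2)

/-! A plain regret bound is not enough for the contextual claim: each copy runs for a random number
of rounds that the principal controls adaptively. The proof therefore asks for a potential `Φ` on
the learner's view (`HasRegretPotential`): nonpositive at the start, at least `-c√n` after `n`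
rounds, and such that regret plus `Φ` is a supermartingale against every bounded reward vector. Such
potentials add up over contexts. Only the term of the drawn signal moves, and at the end
Cauchy–Schwarz gives `∑ √(n s) ≤ √(|S| T)` (`HasRegretPotential.contextual_regret_le`).

The algorithm mixes learners `i : I`, each running follow-the-regularised-leader with the
1/2-Tsallis regulariser on importance-weighted losses. The potential is the sum of the learners'
estimated regrets, measured by the optimal regularised value, minus a multiple of `√n`. Stability of
that value (`le_tsallisValue_add_single`) bounds the cost of a round, and the weight `√n/√|I|` makes
the total of order `√(|I||A|n)`. A single learner gives external regret. One learner per action,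
mixed by a stationary distribution of the proposals as in Blum–Mansour, gives swap-regret. -/

/-! ### Expectation under discrete distributions. -/

section expect

variable {α β : Type*}

theorem PMF.hasSum_toReal (p : PMF α) : HasSum (fun x => (p x).toReal) 1 := by
  have := ENNReal.hasSum_toReal (f := p) (by simp [p.tsum_coe])
  simpa [p.tsum_coe, ← ENNReal.tsum_toReal_eq (fun a => p.apply_ne_top a)] using this

theorem PMF.abs_toReal_mul_le (p : PMF α) {f : α → ℝ} {D : ℝ} (hf : ∀ x ∈ p.support, |f x| ≤ D)
    (x : α) : |(p x).toReal * f x| ≤ (p x).toReal * D := by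
  by_cases hx : p x = 0
  · simp [hx]
  · rw [abs_mul, abs_of_nonneg ENNReal.toReal_nonneg]
    exact mul_le_mul_of_nonneg_left (hf x ((p.mem_support_iff x).2 hx)) ENNReal.toReal_nonneg

/-- A `tsum` that is not summable has the default value 0, so the rules that need summability carry
a uniform bound, asked only on the support. -/
theorem PMF.summable_expect (p : PMF α) {f : α → ℝ} {D : ℝ} (hf : ∀ x ∈ p.support, |f x| ≤ D) :
    Summable fun x => (p x).toReal * f x :=
  Summable.of_abs (Summable.of_nonneg_of_le (fun _ => abs_nonneg _) (p.abs_toReal_mul_le hf)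
    (p.hasSum_toReal.summable.mul_right D))

theorem PMF.expect_congr (p : PMF α) {f g : α → ℝ} (h : ∀ x ∈ p.support, f x = g x) :
    p.expect f = p.expect g := by
  refine tsum_congr fun x => ?_
  by_cases hx : p x = 0
  · simp [hx]
  · rw [h x ((p.mem_support_iff x).2 hx)]

theorem PMF.expect_le (p : PMF α) {f : α → ℝ} {D c : ℝ} (hf : ∀ x ∈ p.support, |f x| ≤ D)
    (hc : ∀ x ∈ p.support, f x ≤ c) : p.expect f ≤ c := by
  have h2 := p.hasSum_toReal.mul_right c
  rw [one_mul] at h2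
  refine hasSum_le (fun x => ?_) (p.summable_expect hf).hasSum h2
  by_cases hx : p x = 0
  · simp [hx]
  · exact mul_le_mul_of_nonneg_left (hc x ((p.mem_support_iff x).2 hx)) ENNReal.toReal_nonneg

theorem PMF.expect_neg (p : PMF α) (f : α → ℝ) : p.expect (fun x => -f x) = -p.expect f := by
  simp [PMF.expect, tsum_neg]

theorem PMF.abs_expect_le (p : PMF α) {f : α → ℝ} {D : ℝ} (hf : ∀ x ∈ p.support, |f x| ≤ D) :
    |p.expect f| ≤ D := by
  refine abs_le.2 ⟨?_, p.expect_le hf fun x hx => (abs_le.1 (hf x hx)).2⟩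
  have := p.expect_le (f := fun x => -f x) (D := D) (c := D) (by simpa using hf)
    fun x hx => by linarith [(abs_le.1 (hf x hx)).1]
  rw [p.expect_neg] at this
  linarith

theorem PMF.expect_const_add (p : PMF α) {f : α → ℝ} {D : ℝ} (hf : ∀ x ∈ p.support, |f x| ≤ D)
    (c : ℝ) : p.expect (fun x => c + f x) = c + p.expect f := by
  have h := (p.hasSum_toReal.mul_right c).add (p.summable_expect hf).hasSum
  rw [one_mul] at h
  simpa only [PMF.expect, mul_add] using h.tsum_eq

theorem PMF.expect_pure (a : α) (f : α → ℝ) : (PMF.pure a).expect f = f a := by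
  classical
  unfold PMF.expect
  rw [tsum_eq_single a fun b hb => by simp [PMF.pure_apply, hb]]
  simp

theorem PMF.expect_fintype [Fintype α] (p : PMF α) (f : α → ℝ) :
    p.expect f = ∑ a, (p a).toReal * f a :=
  tsum_fintype _

theorem PMF.expect_bind (p : PMF α) (q : α → PMF β) {f : β → ℝ} {D : ℝ}
    (hf : ∀ y ∈ (p.bind q).support, |f y| ≤ D) :
    (p.bind q).expect f = p.expect fun a => (q a).expect f := by
  have hD : ∀ a b, |(p a).toReal * (q a b).toReal * f b| ≤ (p a).toReal * (q a b).toReal * D := by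
    intro a b
    by_cases h : p a = 0 ∨ q a b = 0
    · rcases h with h | h <;> simp [h]
    · push Not at h
      rw [abs_mul, abs_of_nonneg (by positivity)]
      refine mul_le_mul_of_nonneg_left (hf b ?_) (by positivity)
      rw [PMF.mem_support_bind_iff]
      exact ⟨a, (p.mem_support_iff a).2 h.1, ((q a).mem_support_iff b).2 h.2⟩
  have hs1 : Summable fun z : α × β => (p z.1).toReal * (q z.1 z.2).toReal := by
    have h0 : ∀ z : α × β, 0 ≤ (p z.1).toReal * (q z.1 z.2).toReal := fun z =>
      mul_nonneg ENNReal.toReal_nonneg ENNReal.toReal_nonneg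
    refine (summable_prod_of_nonneg h0).2 ⟨fun a => ?_, ?_⟩
    · have h := (q a).hasSum_toReal.summable.mul_left (p a).toReal
      exact h
    · have e : (fun a => ∑' b, (p a).toReal * (q a b).toReal) = fun a => (p a).toReal := by
        ext a
        rw [tsum_mul_left, (q a).hasSum_toReal.tsum_eq, mul_one]
      have h := p.hasSum_toReal.summable
      rw [← e] at h
      exact h
  have hs : Summable fun z : α × β => (p z.1).toReal * (q z.1 z.2).toReal * f z.2 :=
    Summable.of_abs (Summable.of_nonneg_of_le (fun _ => abs_nonneg _) (fun z => hD z.1 z.2)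
      (hs1.mul_right D))
  calc (p.bind q).expect f
      = ∑' b, ∑' a, (p a).toReal * (q a b).toReal * f b := by
        refine tsum_congr fun b => ?_
        have h : (p.bind q b).toReal = ∑' a, (p a).toReal * (q a b).toReal := by
          rw [PMF.bind_apply, ENNReal.tsum_toReal_eq]
          · simp only [ENNReal.toReal_mul]
          · exact fun a => ENNReal.mul_ne_top (p.apply_ne_top a) ((q a).apply_ne_top b)
        rw [h, tsum_mul_right]
    _ = ∑' a, ∑' b, (p a).toReal * (q a b).toReal * f b :=
        (Summable.tsum_comm (f := fun a b => (p a).toReal * (q a b).toReal * f b) hs)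
    _ = p.expect fun a => (q a).expect f := by
        simp only [PMF.expect, mul_assoc, tsum_mul_left]

theorem PMF.expect_map (p : PMF α) (g : α → β) {f : β → ℝ} {D : ℝ}
    (hf : ∀ x ∈ p.support, |f (g x)| ≤ D) :
    (p.map g).expect f = p.expect fun a => f (g a) := by
  rw [PMF.map, PMF.expect_bind (D := D)]
  · simp [PMF.expect_pure]
  · intro y hy
    rw [PMF.mem_support_bind_iff] at hy
    obtain ⟨a, ha, hy⟩ := hy
    simp at hy
    exact hy ▸ hf a ha

end expect

/-! ### History processes and the supermartingale bound. -/

section value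

variable {α : Type*}

/-- The law of the first rounds of a process whose next round, given the history, has law `κ`. -/
noncomputable def historyLaw (κ : List α → PMF α) : ℕ → PMF (List α)
  | 0 => PMF.pure []
  | n + 1 => (historyLaw κ n).bind fun h => (κ h).map fun z => z :: h

theorem abs_sum_le_of_mem_historyLaw (κ : List α → PMF α) {inc : α → ℝ} {D : ℝ}
    (hinc : ∀ h, ∀ z ∈ (κ h).support, |inc z| ≤ D) (n : ℕ) :
    ∀ h ∈ (historyLaw κ n).support, |(h.map inc).sum| ≤ n * D := by
  induction n with
  | zero => simp [historyLaw]
  | succ n ih =>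
    intro h hh
    simp only [historyLaw, PMF.mem_support_bind_iff, PMF.mem_support_map_iff] at hh
    obtain ⟨h', hh', z, hz, rfl⟩ := hh
    have h1 := ih h' hh'
    have h2 := hinc h' z hz
    have := abs_add_le (inc z) (h'.map inc).sum
    simp only [List.map_cons, List.sum_cons, Nat.cast_add, Nat.cast_one]
    linarith

/-- The expected total of the increments of the next `k` rounds plus a final constant `c`. -/
noncomputable def expectedFuture (κ : List α → PMF α) (inc : α → ℝ) (c : ℝ) : ℕ → List α → ℝ
  | 0 => fun _ => c
  | k + 1 => fun h => (κ h).expect fun z => inc z + expectedFuture κ inc c k (z :: h)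

theorem abs_expectedFuture_le (κ : List α → PMF α) {inc : α → ℝ} {D : ℝ}
    (hinc : ∀ h, ∀ z ∈ (κ h).support, |inc z| ≤ D) (c : ℝ) (k : ℕ) :
    ∀ h, |expectedFuture κ inc c k h| ≤ |c| + k * D := by
  induction k with
  | zero => simp [expectedFuture]
  | succ k ih =>
    intro h
    refine PMF.abs_expect_le _ fun z hz => ?_
    have h1 := ih (z :: h)
    have h2 := hinc h z hz
    have := abs_add_le (inc z) (expectedFuture κ inc c k (z :: h))
    push_cast
    linarith

/-- Tower property: the induction moves the last past round into the future, trading `n + 1, k` for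
`n, k + 1`. -/
theorem expect_historyLaw_add_expectedFuture (κ : List α → PMF α) {inc : α → ℝ} {D : ℝ}
    (hinc : ∀ h, ∀ z ∈ (κ h).support, |inc z| ≤ D) (c : ℝ) (k : ℕ) : ∀ n : ℕ,
    (historyLaw κ n).expect (fun h => (h.map inc).sum + expectedFuture κ inc c k h)
      = expectedFuture κ inc c (n + k) [] := by
  intro n
  induction n generalizing k with
  | zero => simp [historyLaw, PMF.expect_pure]
  | succ n ih =>
    have hb : ∀ h ∈ (historyLaw κ (n + 1)).support,
        |(h.map inc).sum + expectedFuture κ inc c k h|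
          ≤ ((n + 1 : ℕ) * D) + (|c| + k * D) := fun h hh =>
      (abs_add_le _ _).trans (add_le_add (abs_sum_le_of_mem_historyLaw κ hinc _ h hh)
        (abs_expectedFuture_le κ hinc c k h))
    rw [show n + 1 + k = n + (k + 1) by ring, ← ih (k + 1)]
    rw [historyLaw] at hb ⊢
    rw [PMF.expect_bind _ _ hb]
    refine PMF.expect_congr _ fun h hh => ?_
    rw [PMF.expect_map (D := ((n + 1 : ℕ) * D) + (|c| + k * D))]
    · have := PMF.expect_const_add (κ h)
        (f := fun z => inc z + expectedFuture κ inc c k (z :: h)) (D := D + (|c| + k * D))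
        (fun z hz => (abs_add_le _ _).trans (add_le_add (hinc h z hz)
          (abs_expectedFuture_le κ hinc c k _))) (h.map inc).sum
      rw [expectedFuture, ← this]
      congr 1
      ext z
      simp only [List.map_cons, List.sum_cons]
      ring
    · intro z hz
      refine hb _ ?_
      simp only [PMF.mem_support_bind_iff, PMF.mem_support_map_iff]
      exact ⟨h, hh, z, hz, rfl⟩

/-- A supermartingale bound. No integrability of the potential `Ψ` is needed: the one-step
inequality is only required for bounded functions below it. -/
theorem expect_historyLaw_sum_le (κ : List α → PMF α) {inc : α → ℝ} {D : ℝ}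
    (hinc : ∀ h, ∀ z ∈ (κ h).support, |inc z| ≤ D) (Ψ : List α → ℝ)
    (hstep : ∀ (h : List α) (f : α → ℝ) (E : ℝ), (∀ z, |f z| ≤ E) → (∀ z, f z ≤ Ψ (z :: h)) →
      (κ h).expect (fun z => inc z + f z) ≤ Ψ h)
    {T : ℕ} {R : ℝ} (hfinal : ∀ h : List α, h.length = T → -R ≤ Ψ h) :
    (historyLaw κ T).expect (fun h => (h.map inc).sum) ≤ Ψ [] + R := by
  -- Backward induction from the horizon. The value with terminal constant `-R` is bounded, hence an
  -- admissible `f` in `hstep`, even when `Ψ` is not integrable.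
  have hW : ∀ k h, h.length + k = T → expectedFuture κ inc (-R) k h ≤ Ψ h := by
    intro k
    induction k with
    | zero => exact fun h hh => hfinal h hh
    | succ k ih =>
      intro h hh
      refine hstep h _ _ (fun z => abs_expectedFuture_le κ hinc (-R) k (z :: h)) fun z => ?_
      exact ih _ (by simp only [List.length_cons]; omega)
  have h0 := expect_historyLaw_add_expectedFuture κ hinc (-R) 0 T
  have h1 := PMF.expect_const_add (historyLaw κ T)
    (abs_sum_le_of_mem_historyLaw κ hinc T) (-R)
  have h2 := hW T [] (by simp)
  simp only [expectedFuture, add_zero] at h0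
  simp only [add_comm (-R)] at h1
  linarith

end value

/-! ### Regret potentials and their two consequences. -/

section certificate

variable {A : Type*} [Fintype A]

/-- A potential certifying that the regret of `alg` with respect to the deviation `dev` is at most
`c * √n` after `n` rounds, even if `n` is a stopping time. -/
def HasRegretPotential (B c : ℝ) (alg : BanditAlgorithm A) (dev : A → A) : Prop :=
  ∃ Φ : List (A × ℝ) → ℝ, Φ [] ≤ 0 ∧ (∀ h, -(c * √h.length) ≤ Φ h) ∧
    ∀ (h : List (A × ℝ)) (r : A → ℝ), (∀ a, |r a| ≤ B) →
      ∑ a, (alg h a).toReal * (r (dev a) - r a + Φ ((a, r a) :: h)) ≤ Φ h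

theorem abs_sub_le_two_mul {B x y : ℝ} (hx : |x| ≤ B) (hy : |y| ≤ B) : |x - y| ≤ 2 * B :=
  (abs_sub x y).trans (by linarith)

/-- Given the history, the reward vector is drawn before the action and the action does not depend
on it. The one-step inequality thus applies to each vector separately and is then averaged. -/
theorem HasRegretPotential.bandit_regret_le {B c : ℝ} {alg : BanditAlgorithm A} {dev : A → A}
    (H : HasRegretPotential B c alg dev) (adv : BanditAdversary A) (hadv : adv.BoundedBy B)
    (T : ℕ) :
    (banditLaw alg adv T).expect (fun h => (h.map fun z => z.1 (dev z.2) - z.1 z.2).sum)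
      ≤ c * √T := by
  obtain ⟨Φ, h0, hlow, hstep⟩ := H
  let view : List ((A → ℝ) × A) → List (A × ℝ) := fun h => h.map fun z => (z.2, z.1 z.2)
  let κ : List ((A → ℝ) × A) → PMF ((A → ℝ) × A) := fun h =>
    (adv h).bind fun r => (alg (view h)).map fun a => (r, a)
  have hlaw : ∀ n, banditLaw alg adv n = historyLaw κ n := by
    intro n
    induction n with
    | zero => rfl
    | succ n ih => simp [banditLaw, historyLaw, ih, κ, view, PMF.map_bind, PMF.map_comp,
        Function.comp_def]
  have hinc : ∀ h, ∀ z ∈ (κ h).support, |z.1 (dev z.2) - z.1 z.2| ≤ 2 * B := by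
    intro h z hz
    simp only [κ, PMF.mem_support_bind_iff, PMF.mem_support_map_iff] at hz
    obtain ⟨r, hr, a, -, rfl⟩ := hz
    exact abs_sub_le_two_mul (hadv h r hr _) (hadv h r hr _)
  have := expect_historyLaw_sum_le κ (T := T) (R := c * √T) hinc (fun h => Φ (view h)) ?_ ?_
  · rw [hlaw]
    have e : Φ (view []) = Φ [] := rfl
    simp only [e] at this
    linarith
  · intro h f E hfE hfΨ
    have hb : ∀ z ∈ (κ h).support, |z.1 (dev z.2) - z.1 z.2 + f z| ≤ 2 * B + E := fun z hz =>
      (abs_add_le _ _).trans (add_le_add (hinc h z hz) (hfE z))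
    rw [PMF.expect_bind _ _ hb]
    have hb' : ∀ r ∈ (adv h).support, ∀ a, |r (dev a) - r a + f (r, a)| ≤ 2 * B + E :=
      fun r hr a => (abs_add_le _ _).trans (add_le_add
        (abs_sub_le_two_mul (hadv h r hr _) (hadv h r hr _)) (hfE _))
    have hmap : ∀ r ∈ (adv h).support,
        ((alg (view h)).map fun a => (r, a)).expect (fun z => z.1 (dev z.2) - z.1 z.2 + f z)
          = (alg (view h)).expect fun a => r (dev a) - r a + f (r, a) := fun r hr =>
      PMF.expect_map _ _ (D := 2 * B + E) fun a _ => hb' r hr a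
    refine PMF.expect_le _ (D := 2 * B + E) (fun r hr => ?_) fun r hr => ?_
    · rw [hmap r hr]
      exact PMF.abs_expect_le _ fun a _ => hb' r hr a
    · rw [hmap r hr, PMF.expect_fintype]
      refine le_trans (Finset.sum_le_sum fun a _ => mul_le_mul_of_nonneg_left
        (add_le_add_right (hfΨ (r, a)) _) ENNReal.toReal_nonneg) (hstep (view h) r (hadv h r hr))
  · intro h hh
    have := hlow (view h)
    simpa only [view, List.length_map, hh] using this

theorem sum_sqrt_le_sqrt_card_mul {S : Type*} [Fintype S] (n : S → ℕ) :
    ∑ s, √(n s) ≤ √(Fintype.card S * (∑ s, n s : ℕ)) := by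
  have h := Real.sum_sqrt_mul_sqrt_le (Finset.univ : Finset S) (f := fun s => (n s : ℝ))
    (g := fun _ => 1) (fun _ => by positivity) (fun _ => zero_le_one)
  rw [mul_comm, Real.sqrt_mul (by positivity)]
  simpa using h

/-- The sum over `s` of the potentials, each evaluated on the rounds with signal `s`, is a potential
for the whole game. The deviation may differ from context to context, but the algorithm and `c` are
common. -/
theorem HasRegretPotential.contextual_regret_le {B c : ℝ} (hc : 0 ≤ c) {alg : BanditAlgorithm A}
    {S X : Type*} [Fintype S] [DecidableEq S] {v : X → A → ℝ} (hv : ∀ x a, |v x a| ≤ B)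
    {dev : S → A → A} (H : ∀ s, HasRegretPotential B c alg (dev s))
    (σ : PrincipalStrategy S X A) (T : ℕ) :
    (gameLaw v (perContext alg S) σ T).expect (fun h =>
      (h.map fun r => v r.decision (dev r.signal r.action) - v r.decision r.action).sum)
      ≤ c * √(Fintype.card S * T) := by
  choose Φ h0 hlow hstep using H
  let view : List (Round S X A) → S → List (A × ℝ) := fun h s =>
    ((agentView v h).filter fun z => z.1 = s).map fun z => z.2
  have view_cons : ∀ (q : S × X) a h s, view (⟨q.1, q.2, a⟩ :: h) s
      = if q.1 = s then (a, v q.2 a) :: view h s else view h s := by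
    intro q a h s
    simp only [view, agentView, List.map_cons, List.filter_cons]
    by_cases hs : q.1 = s <;> simp [hs]
  have hlen : ∀ h, ∑ s, (view h s).length = h.length := by
    intro h
    induction h with
    | nil => simp [view, agentView]
    | cons z h ih =>
      have : ∀ s, (view (z :: h) s).length = (view h s).length + if z.signal = s then 1 else 0 := by
        intro s
        rw [show z = ⟨(z.signal, z.decision).1, (z.signal, z.decision).2, z.action⟩ from rfl,
          view_cons]
        split_ifs <;> simp
      simp [this, Finset.sum_add_distrib, ih]
  let κ : List (Round S X A) → PMF (Round S X A) := fun h =>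
    (σ h).bind fun q => (alg (view h q.1)).map fun a => ⟨q.1, q.2, a⟩
  have hlaw : ∀ n, gameLaw v (perContext alg S) σ n = historyLaw κ n := by
    intro n
    induction n with
    | zero => rfl
    | succ n ih => simp [gameLaw, historyLaw, ih, κ, view, perContext, PMF.map_bind, PMF.map_comp,
        Function.comp_def]
  have hinc : ∀ z : Round S X A,
      |v z.decision (dev z.signal z.action) - v z.decision z.action| ≤ 2 * B :=
    fun z => abs_sub_le_two_mul (hv _ _) (hv _ _)
  have := expect_historyLaw_sum_le κ (T := T) (R := c * √(Fintype.card S * T))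
    (fun _ z _ => hinc z) (fun h => ∑ s, Φ s (view h s)) ?_ ?_
  · rw [hlaw]
    have e : ∑ s, Φ s (view [] s) ≤ 0 := Finset.sum_nonpos fun s _ => h0 s
    linarith
  · intro h f E hfE hfΨ
    have hb : ∀ z, |v z.decision (dev z.signal z.action) - v z.decision z.action + f z|
        ≤ 2 * B + E := fun z => (abs_add_le _ _).trans (add_le_add (hinc z) (hfE z))
    rw [PMF.expect_bind _ _ (D := 2 * B + E) fun z _ => hb z]
    refine PMF.expect_le _ (D := 2 * B + E)
      (fun q _ => PMF.abs_expect_le _ fun z _ => hb z) fun q _ => ?_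
    rw [PMF.expect_map (D := 2 * B + E) (hf := fun a _ => hb ⟨q.1, q.2, a⟩), PMF.expect_fintype]
    -- Only the copy of the drawn signal sees the round; the other terms are constants that pass
    -- through the expectation.
    have hΨ : ∀ a, ∑ s, Φ s (view (⟨q.1, q.2, a⟩ :: h) s)
        = Φ q.1 ((a, v q.2 a) :: view h q.1) + ∑ s ∈ Finset.univ.erase q.1, Φ s (view h s) := by
      intro a
      rw [← Finset.add_sum_erase _ _ (Finset.mem_univ q.1)]
      congr 1
      · rw [view_cons, if_pos rfl]
      · refine Finset.sum_congr rfl fun s hs => ?_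
        rw [view_cons, if_neg (Finset.ne_of_mem_erase hs).symm]
    have hone : ∑ a, (alg (view h q.1) a).toReal = 1 := by
      rw [← tsum_fintype (L := .unconditional _)]
      exact (PMF.hasSum_toReal _).tsum_eq
    calc ∑ a, (alg (view h q.1) a).toReal * (v q.2 (dev q.1 a) - v q.2 a + f ⟨q.1, q.2, a⟩)
        ≤ ∑ a, (alg (view h q.1) a).toReal * (v q.2 (dev q.1 a) - v q.2 a
            + Φ q.1 ((a, v q.2 a) :: view h q.1)
            + ∑ s ∈ Finset.univ.erase q.1, Φ s (view h s)) := by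
          refine Finset.sum_le_sum fun a _ => mul_le_mul_of_nonneg_left ?_ ENNReal.toReal_nonneg
          have := hfΨ ⟨q.1, q.2, a⟩
          rw [hΨ] at this
          linarith
      _ = ∑ a, (alg (view h q.1) a).toReal * (v q.2 (dev q.1 a) - v q.2 a
            + Φ q.1 ((a, v q.2 a) :: view h q.1))
            + ∑ s ∈ Finset.univ.erase q.1, Φ s (view h s) := by
          simp only [mul_add _ _ (∑ s ∈ Finset.univ.erase q.1, Φ s (view h s)),
            Finset.sum_add_distrib, ← Finset.sum_mul, hone, one_mul]
      _ ≤ Φ q.1 (view h q.1) + ∑ s ∈ Finset.univ.erase q.1, Φ s (view h s) :=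
          add_le_add_left (hstep q.1 (view h q.1) (v q.2) (hv q.2)) _
      _ = ∑ s, Φ s (view h s) := Finset.add_sum_erase _ (fun s => Φ s (view h s)) (Finset.mem_univ q.1)
  · intro h hh
    have h1 := sum_sqrt_le_sqrt_card_mul fun s => (view h s).length
    rw [hlen, hh] at h1
    have h2 : ∑ s, -(c * √(view h s).length) ≤ ∑ s, Φ s (view h s) :=
      Finset.sum_le_sum fun s _ => hlow s _
    rw [Finset.sum_neg_distrib, ← Finset.mul_sum] at h2
    nlinarith

end certificate
-- Tsallis-regularised minimisation over the simplex.
open Finset in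
/-- Existence of the minimiser of `q ↦ ∑ L i * q i - 2 * w * ∑ √(q i)` over the simplex, in the
form of its first-order conditions. -/
theorem exists_tsallis_point {A : Type*} [Fintype A] [Nonempty A] {w : ℝ} (hw : 0 < w)
    (L : A → ℝ) :
    ∃ p : A → ℝ, (∀ i, 0 < p i) ∧ ∑ i, p i = 1 ∧ ∃ l : ℝ, ∀ i, L i = l + w / √(p i) := by
  obtain ⟨m, hm⟩ := Finite.exists_min L
  have hK1 : (1 : ℝ) ≤ √(Fintype.card A) := by
    rw [Real.one_le_sqrt]
    exact_mod_cast Fintype.card_pos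
  have hle : L m - w * √(Fintype.card A) ≤ L m - w := by nlinarith
  -- The first-order conditions force `p i = (w / (L i - l))²`, and `g l` is the resulting total
  -- mass. At the left end of the interval every coordinate is at most `1/|A|`; at the right end
  -- coordinate `m` alone is 1. A multiplier of mass 1 lies between.
  let g : ℝ → ℝ := fun l => ∑ i, (w / (L i - l)) ^ 2
  have hpos : ∀ l ≤ L m - w, ∀ i, 0 < L i - l := fun l hl i => by linarith [hm i]
  have hcont : ContinuousOn g (Set.Icc (L m - w * √(Fintype.card A)) (L m - w)) := by
    refine continuousOn_finsetSum _ fun i _ => ContinuousOn.pow ?_ 2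
    refine continuousOn_const.div (by fun_prop) fun l hl => (hpos l hl.2 i).ne'
  have h1 : g (L m - w * √(Fintype.card A)) ≤ 1 := by
    have : ∀ i ∈ (univ : Finset A), (w / (L i - (L m - w * √(Fintype.card A)))) ^ 2
        ≤ 1 / (Fintype.card A : ℝ) := by
      intro i _
      have hs : w * √(Fintype.card A) ≤ L i - (L m - w * √(Fintype.card A)) := by
        linarith [hm i]
      have h0 : 0 < w * √(Fintype.card A) := by positivity
      calc (w / (L i - (L m - w * √(Fintype.card A)))) ^ 2
          ≤ (w / (w * √(Fintype.card A))) ^ 2 :=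
            pow_le_pow_left₀ (div_nonneg hw.le (h0.le.trans hs))
              (div_le_div_of_nonneg_left hw.le h0 hs) 2
        _ = 1 / (Fintype.card A : ℝ) := by
            rw [div_mul_cancel_left₀ hw.ne', inv_pow, Real.sq_sqrt (by positivity), one_div]
    refine (sum_le_sum this).trans ?_
    simp
  have h2 : 1 ≤ g (L m - w) := by
    have : (w / (L m - (L m - w))) ^ 2 ≤ g (L m - w) :=
      single_le_sum (f := fun i => (w / (L i - (L m - w))) ^ 2) (fun i _ => sq_nonneg _)
        (mem_univ m)
    simpa [hw.ne'] using this
  obtain ⟨l, hl, hgl⟩ := intermediate_value_Icc hle hcont ⟨h1, h2⟩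
  have hp := hpos l hl.2
  refine ⟨fun i => (w / (L i - l)) ^ 2, fun i => ?_, hgl, l, fun i => ?_⟩
  · have := hp i
    positivity
  · have := hp i
    rw [Real.sqrt_sq (by positivity)]
    field_simp
    ring

/-- A minimiser of `q ↦ ∑ L i * q i - 2 * w * ∑ √(q i)` over the simplex. -/
noncomputable def tsallisPoint {A : Type*} [Fintype A] [Nonempty A] (w : ℝ) (L : A → ℝ) : A → ℝ :=
  if hw : 0 < w then (exists_tsallis_point hw L).choose else fun _ => 0

section tsallis

variable {A : Type*} [Fintype A] {w : ℝ}

theorem tsallisPoint_pos [Nonempty A] (hw : 0 < w) (L : A → ℝ) (i : A) : 0 < tsallisPoint w L i := by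
  rw [tsallisPoint, dif_pos hw]
  exact (exists_tsallis_point hw L).choose_spec.1 i

theorem sum_tsallisPoint [Nonempty A] (hw : 0 < w) (L : A → ℝ) : ∑ i, tsallisPoint w L i = 1 := by
  rw [tsallisPoint, dif_pos hw]
  exact (exists_tsallis_point hw L).choose_spec.2.1

theorem tsallisPoint_kkt [Nonempty A] (hw : 0 < w) (L : A → ℝ) :
    ∃ l : ℝ, ∀ i, L i = l + w / √(tsallisPoint w L i) := by
  rw [tsallisPoint, dif_pos hw]
  exact (exists_tsallis_point hw L).choose_spec.2.2

/-- The objective of follow-the-regularised-leader with the `1/2`-Tsallis regulariser. -/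
noncomputable def tsallisObjective (w : ℝ) (L q : A → ℝ) : ℝ :=
  ∑ i, L i * q i - 2 * w * ∑ i, √(q i)

/-- The minimum of the regularised objective over the simplex. -/
noncomputable def tsallisValue (w : ℝ) (L : A → ℝ) : ℝ :=
  ⨅ q : stdSimplex ℝ A, tsallisObjective w L q

instance [Nonempty A] : Nonempty (stdSimplex ℝ A) := by
  classical
  exact ⟨⟨_, single_mem_stdSimplex ℝ (Classical.arbitrary A)⟩⟩

theorem tsallisValue_le (w : ℝ) (L : A → ℝ) {q : A → ℝ} (hq : q ∈ stdSimplex ℝ A) :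
    tsallisValue w L ≤ tsallisObjective w L q := by
  have hc : Continuous fun q : A → ℝ => tsallisObjective w L q := by
    unfold tsallisObjective
    fun_prop
  have hb := (isCompact_stdSimplex ℝ A).bddBelow_image hc.continuousOn
  refine ciInf_le (f := fun q : stdSimplex ℝ A => tsallisObjective w L q) ?_ ⟨q, hq⟩
  refine hb.mono ?_
  rintro _ ⟨q, rfl⟩
  exact ⟨q, q.2, rfl⟩

/-- Evaluate at the vertex `b`: the regulariser only lowers the objective. This makes the learners'
estimated regrets nonnegative. -/
theorem tsallisValue_le_apply (hw : 0 ≤ w) (L : A → ℝ) (b : A) : tsallisValue w L ≤ L b := by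
  classical
  refine (tsallisValue_le w L (single_mem_stdSimplex ℝ b)).trans ?_
  have : 0 ≤ ∑ i, √(Pi.single (M := fun _ => ℝ) b 1 i) :=
    Finset.sum_nonneg fun i _ => Real.sqrt_nonneg _
  simp only [tsallisObjective, Pi.single_apply, mul_ite, mul_one, mul_zero, Finset.sum_ite_eq',
    Finset.mem_univ, if_true] at this ⊢
  nlinarith

theorem sum_sqrt_le_sqrt_card {q : A → ℝ} (hq : q ∈ stdSimplex ℝ A) :
    ∑ i, √(q i) ≤ √(Fintype.card A) := by
  have h := Real.sum_sqrt_mul_sqrt_le (Finset.univ : Finset A) (f := q) (g := fun _ => 1) hq.1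
    (fun _ => zero_le_one)
  simpa [hq.2] using h

/-- The price of letting the weight grow: at each point of the simplex the objective drops by at
most this amount, as `∑ √(q i) ≤ √|A|`. -/
theorem tsallisValue_sub_le [Nonempty A] {w' : ℝ} (hww : w' ≤ w) (L : A → ℝ) :
    tsallisValue w' L - 2 * (w - w') * √(Fintype.card A) ≤ tsallisValue w L := by
  refine le_ciInf fun q' => ?_
  obtain ⟨q, hq⟩ := q'
  change _ ≤ tsallisObjective w L q
  have h1 := tsallisValue_le w' L hq
  have h2 := mul_le_mul_of_nonneg_left (sum_sqrt_le_sqrt_card hq) (sub_nonneg.2 hww)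
  simp only [tsallisObjective] at h1 ⊢
  linarith

/-- The key stability estimate: increasing the loss of one action. -/
theorem le_tsallisValue_add_single [Nonempty A] [DecidableEq A] (hw : 0 < w) (L : A → ℝ) (a : A) {u : ℝ}
    (hu : 0 ≤ u) :
    tsallisValue w L + tsallisPoint w L a * u
      - tsallisPoint w L a * √(tsallisPoint w L a) * u ^ 2 / w
      ≤ tsallisValue w (L + Pi.single a u) := by
  obtain ⟨l, hl⟩ := tsallisPoint_kkt hw L
  have hp := tsallisPoint_pos hw L
  have hps := sum_tsallisPoint hw L
  set p := tsallisPoint w L with hpdef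
  refine le_ciInf fun q' => ?_
  obtain ⟨q, hq⟩ := q'
  have hq0 := hq.1
  have hq1 := hq.2
  change _ ≤ tsallisObjective w (L + Pi.single a u) q
  have hval := tsallisValue_le w L (q := p) ⟨fun i => (hp i).le, hps⟩
  have hobj : tsallisObjective w (L + Pi.single a u) q
      = tsallisObjective w L q + u * q a := by
    simp [tsallisObjective, add_mul, Finset.sum_add_distrib, Pi.single_apply]
    ring
  -- By the first-order conditions the excess over the minimum is exactly the Bregman divergence of
  -- the regulariser, here a sum of nonnegative terms. Only the term at `a` is kept below.
  have hdiff : tsallisObjective w L q - tsallisObjective w L p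
      = ∑ i, w * ((√(q i) - √(p i)) ^ 2 / √(p i)) := by
    have hL : ∑ i, L i * q i - ∑ i, L i * p i = ∑ i, w / √(p i) * (q i - p i) := by
      have : ∑ i, w / √(p i) * (q i - p i) = ∑ i, (L i - l) * (q i - p i) :=
        Finset.sum_congr rfl fun i _ => by rw [hl i]; ring
      rw [this]
      simp only [sub_mul, mul_sub, Finset.sum_sub_distrib, ← Finset.mul_sum, hps, hq1]
      ring
    have : tsallisObjective w L q - tsallisObjective w L p
        = (∑ i, L i * q i - ∑ i, L i * p i) - 2 * w * (∑ i, √(q i) - ∑ i, √(p i)) := by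
      unfold tsallisObjective; ring
    rw [this, hL, ← Finset.sum_sub_distrib, Finset.mul_sum, ← Finset.sum_sub_distrib]
    refine Finset.sum_congr rfl fun i _ => ?_
    have hs : 0 < √(p i) := Real.sqrt_pos.2 (hp i)
    have e1 := Real.sq_sqrt (hq0 i)
    have e2 := Real.sq_sqrt (hp i).le
    rw [← e1, Real.sqrt_sq (Real.sqrt_nonneg _)]
    conv_lhs => rw [← e2, Real.sqrt_sq hs.le]
    field_simp
    ring
  have hterm : w * ((√(q a) - √(p a)) ^ 2 / √(p a))
      ≤ ∑ i, w * ((√(q i) - √(p i)) ^ 2 / √(p i)) :=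
    Finset.single_le_sum (f := fun i => w * ((√(q i) - √(p i)) ^ 2 / √(p i)))
      (fun i _ => by positivity) (Finset.mem_univ a)
  -- With `x = √(q a)` and `y = √(p a)`, multiplying by `w * y` turns the difference of the two
  -- sides into a square plus a term nonnegative because `0 ≤ u`.
  have hkey : -(p a * √(p a) * u ^ 2 / w)
      ≤ w * ((√(q a) - √(p a)) ^ 2 / √(p a)) + u * (q a - p a) := by
    have hy : 0 < √(p a) := Real.sqrt_pos.2 (hp a)
    have hx : 0 ≤ √(q a) := Real.sqrt_nonneg _
    have e1 := Real.sq_sqrt (hq0 a)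
    have e2 := Real.sq_sqrt (hp a).le
    generalize √(q a) = x at *
    generalize √(p a) = y at *
    rw [← e1, ← e2, ← sub_nonneg]
    have : w * ((x - y) ^ 2 / y) + u * (x ^ 2 - y ^ 2) - -(y ^ 2 * y * u ^ 2 / w)
        = ((w * (x - y) + u * y ^ 2) ^ 2 + u * w * y * (x - y) ^ 2) / (w * y) := by
      field_simp
      ring
    rw [this]
    positivity
  rw [hobj]
  linarith

end tsallis

/-! ### Stationary distributions. -/

/-- A row-stochastic matrix has a stationary distribution. -/
theorem exists_stationary {A : Type*} [Fintype A] [Nonempty A] (Q : A → A → ℝ)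
    (hQ : ∀ i j, 0 ≤ Q i j) (hQ1 : ∀ i, ∑ j, Q i j = 1) :
    ∃ p : A → ℝ, (∀ i, 0 ≤ p i) ∧ ∑ i, p i = 1 ∧ ∀ j, ∑ i, p i * Q i j = p j := by
  classical
  -- The constant vector is a right null vector, so a left null vector `x` exists; its signs are
  -- still unknown.
  have hdet : (Matrix.of Q - 1).det = 0 := by
    refine Matrix.exists_mulVec_eq_zero_iff.1 ⟨fun _ => 1, ?_, ?_⟩
    · intro h
      exact one_ne_zero (congrFun h (Classical.arbitrary A))
    · ext i
      simp only [Matrix.sub_mulVec, Matrix.one_mulVec]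
      simp [Matrix.mulVec, dotProduct, hQ1]
  obtain ⟨x, hx0, hx⟩ := Matrix.exists_vecMul_eq_zero_iff.2 hdet
  have hxQ : ∀ j, ∑ i, x i * Q i j = x j := by
    intro j
    have := congrFun hx j
    simp only [Matrix.vecMul_sub, Matrix.vecMul_one, Pi.sub_apply, Pi.zero_apply] at this
    simpa [Matrix.vecMul, dotProduct] using sub_eq_zero.1 this
  have hle : ∀ j ∈ (Finset.univ : Finset A), |x j| ≤ ∑ i, |x i| * Q i j := by
    intro j _
    calc |x j| = |∑ i, x i * Q i j| := by rw [hxQ]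
      _ ≤ ∑ i, |x i * Q i j| := Finset.abs_sum_le_sum_abs _ _
      _ = ∑ i, |x i| * Q i j := by simp only [abs_mul, abs_of_nonneg (hQ _ _)]
  have hsum : ∑ j, |x j| = ∑ j, ∑ i, |x i| * Q i j := by
    rw [Finset.sum_comm]
    simp only [← Finset.mul_sum, hQ1, mul_one]
  -- Coordinatewise `|x| ≤ |x| Q`, and the totals agree because rows sum to 1. So equality holds and
  -- `|x|` is itself stationary.
  have heq := (Finset.sum_eq_sum_iff_of_le hle).1 hsum
  have hpos : 0 < ∑ j, |x j| := by
    obtain ⟨i, hi⟩ := Function.ne_iff.1 hx0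
    exact Finset.sum_pos' (fun _ _ => abs_nonneg _) ⟨i, Finset.mem_univ i, abs_pos.2 hi⟩
  refine ⟨fun i => |x i| / ∑ j, |x j|, fun i => by positivity, ?_, fun j => ?_⟩
  · rw [← Finset.sum_div, div_self hpos.ne']
  · simp only [div_mul_eq_mul_div]
    rw [← Finset.sum_div, ← heq j (Finset.mem_univ j)]
-- Mixtures of Tsallis learners and their potential.
section mixture

variable {A I : Type*} [Fintype A] [Nonempty A] [Fintype I]

/-- One round of mixed Tsallis learners with importance-weighted loss estimates. -/
theorem le_sum_tsallisValue_add_estimate [DecidableEq A] {w w' : ℝ} (hw : 0 < w) (hww : w' ≤ w) (L : I → A → ℝ)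
    {π : I → ℝ} (hπ : ∀ i, 0 ≤ π i) (hπ1 : ∑ i, π i = 1) {p : A → ℝ} (hp : ∀ a, 0 < p a)
    (hpπ : ∀ a, p a = ∑ i, π i * tsallisPoint w (L i) a) {l : A → ℝ} (hl0 : ∀ a, 0 ≤ l a)
    (hl1 : ∀ a, l a ≤ 1) :
    ∑ i, tsallisValue w' (L i) + ∑ a, p a * l a - √(Fintype.card A) / w
        - Fintype.card I * (2 * (w - w') * √(Fintype.card A))
      ≤ ∑ a, p a * ∑ i, tsallisValue w (L i + Pi.single a (π i * l a / p a)) := by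
  set Q : I → A → ℝ := fun i => tsallisPoint w (L i) with hQ
  have hQpos : ∀ i a, 0 < Q i a := fun i => tsallisPoint_pos hw (L i)
  have hQ1 : ∀ i, ∑ a, Q i a = 1 := fun i => sum_tsallisPoint hw (L i)
  have hp1 : ∑ a, p a = 1 := by
    simp only [hpπ]
    rw [Finset.sum_comm]
    simp only [← Finset.mul_sum]
    rw [← hπ1]
    exact Finset.sum_congr rfl fun i _ => by rw [hQ1 i, mul_one]
  have hterm : ∀ i a, p a * tsallisValue w (L i) + π i * Q i a * l a - π i * √(Q i a) / w
      ≤ p a * tsallisValue w (L i + Pi.single a (π i * l a / p a)) := by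
    intro i a
    have hu : 0 ≤ π i * l a / p a := div_nonneg (mul_nonneg (hπ i) (hl0 a)) (hp a).le
    have h := mul_le_mul_of_nonneg_left (le_tsallisValue_add_single hw (L i) a hu) (hp a).le
    refine le_trans ?_ h
    have hpi : π i * Q i a ≤ p a := by
      rw [hpπ a]
      exact Finset.single_le_sum (f := fun i => π i * Q i a)
        (fun j _ => mul_nonneg (hπ j) (hQpos j a).le) (Finset.mem_univ i)
    have e1 : p a * (Q i a * (π i * l a / p a)) = π i * Q i a * l a := by
      have := (hp a).ne'
      field_simp
    -- Scaling the loss by `π i` cancels the variance of importance weighting, since `π i * Q i a ≤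
    -- p a`. A factor `π i` survives, so summing over the learners costs `∑ π i = 1` and not `|I|`.
    have e2 : p a * (Q i a * √(Q i a) * (π i * l a / p a) ^ 2 / w) ≤ π i * √(Q i a) / w := by
      have : p a * (Q i a * √(Q i a) * (π i * l a / p a) ^ 2 / w)
          = (π i * √(Q i a) / w) * (π i * Q i a / p a * l a ^ 2) := by
        have := (hp a).ne'
        field_simp
      rw [this]
      refine mul_le_of_le_one_right (div_nonneg (mul_nonneg (hπ i) (Real.sqrt_nonneg _)) hw.le) ?_
      exact mul_le_one₀ (div_le_one_of_le₀ hpi (hp a).le) (sq_nonneg _)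
        (pow_le_one₀ (hl0 a) (hl1 a))
    have e : tsallisPoint w (L i) a = Q i a := rfl
    rw [e]
    linarith
  have hvalue : ∀ i, tsallisValue w' (L i) - 2 * (w - w') * √(Fintype.card A)
      + ∑ a, π i * Q i a * l a - π i * √(Fintype.card A) / w
      ≤ ∑ a, p a * tsallisValue w (L i + Pi.single a (π i * l a / p a)) := by
    intro i
    refine le_trans ?_ (Finset.sum_le_sum fun a _ => hterm i a)
    rw [Finset.sum_sub_distrib, Finset.sum_add_distrib, ← Finset.sum_mul, hp1, one_mul,
      ← Finset.sum_div, ← Finset.mul_sum]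
    have h1 := tsallisValue_sub_le hww (L i)
    have h2 := sum_sqrt_le_sqrt_card (q := Q i) ⟨fun a => (hQpos i a).le, hQ1 i⟩
    have h3 : π i * (∑ a, √(Q i a)) / w ≤ π i * √(Fintype.card A) / w :=
      div_le_div_of_nonneg_right (mul_le_mul_of_nonneg_left h2 (hπ i)) hw.le
    linarith
  have hexchange : ∑ a, p a * ∑ i, tsallisValue w (L i + Pi.single a (π i * l a / p a))
      = ∑ i, ∑ a, p a * tsallisValue w (L i + Pi.single a (π i * l a / p a)) := by
    simp only [Finset.mul_sum]
    exact Finset.sum_comm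
  have hmean : ∑ i, ∑ a, π i * Q i a * l a = ∑ a, p a * l a := by
    rw [Finset.sum_comm]
    exact Finset.sum_congr rfl fun a _ => by rw [hpπ a, Finset.sum_mul]
  rw [hexchange]
  refine le_trans (le_of_eq ?_) (Finset.sum_le_sum fun i _ => hvalue i)
  rw [Finset.sum_sub_distrib, Finset.sum_add_distrib, Finset.sum_sub_distrib, hmean,
    ← Finset.sum_div, ← Finset.sum_mul (f := π), hπ1, one_mul, Finset.sum_const, Finset.card_univ,
    nsmul_eq_mul]
  ring

/-- A rule that turns the distributions proposed by learners `i : I` into weights of the learners. -/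
def IsMixingRule (mix : (I → A → ℝ) → I → ℝ) : Prop :=
  ∀ Q : I → A → ℝ, (∀ i a, 0 < Q i a) → (∀ i, ∑ a, Q i a = 1) →
    (∀ i, 0 ≤ mix Q i) ∧ ∑ i, mix Q i = 1

variable (I) in
/-- The weight of the regulariser after `n` rounds. -/
noncomputable def regularizerWeight (n : ℕ) : ℝ := √n / √(Fintype.card I)

/-- The distributions proposed by the learners after `n` rounds, given their estimated losses. -/
noncomputable def proposals (n : ℕ) (L : I → A → ℝ) : I → A → ℝ :=
  fun i => tsallisPoint (regularizerWeight I (n + 1)) (L i)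

/-- The distribution of the action after `n` rounds, given the estimated losses. -/
noncomputable def mixedAction (mix : (I → A → ℝ) → I → ℝ) (n : ℕ) (L : I → A → ℝ) : A → ℝ :=
  fun a => ∑ i, mix (proposals n L) i * proposals n L i a

/-- The cumulative importance-weighted loss estimates of the learners; rewards in `[-B, B]` are
turned into losses in `[0, 1]`, and the loss vector fed to a learner is scaled by its weight. -/
noncomputable def estimatedLoss [DecidableEq A] (mix : (I → A → ℝ) → I → ℝ) (B : ℝ) :
    List (A × ℝ) → I → A → ℝ
  | [] => 0
  | z :: h => fun i => estimatedLoss mix B h i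
      + Pi.single z.1 (mix (proposals h.length (estimatedLoss mix B h)) i * ((B - z.2) / (2 * B))
        / mixedAction mix h.length (estimatedLoss mix B h) z.1)

variable [Nonempty I]

theorem regularizerWeight_succ_pos (n : ℕ) : 0 < regularizerWeight I (n + 1) := by
  have : (0 : ℝ) < Fintype.card I := by exact_mod_cast Fintype.card_pos
  unfold regularizerWeight
  positivity

theorem regularizerWeight_mono (n : ℕ) : regularizerWeight I n ≤ regularizerWeight I (n + 1) := by
  unfold regularizerWeight
  gcongr
  exact n.le_succ

theorem mixedAction_pos {mix : (I → A → ℝ) → I → ℝ} (hmix : IsMixingRule mix) (n : ℕ)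
    (L : I → A → ℝ) (a : A) : 0 < mixedAction mix n L a := by
  have hQ : ∀ i a, 0 < proposals n L i a :=
    fun i => tsallisPoint_pos (regularizerWeight_succ_pos n) (L i)
  obtain ⟨h0, h1⟩ := hmix (proposals n L) hQ
    fun i => sum_tsallisPoint (regularizerWeight_succ_pos n) (L i)
  obtain ⟨i, -, hi⟩ : ∃ i ∈ Finset.univ, 0 < mix (proposals n L) i :=
    Finset.exists_lt_of_sum_lt (f := fun _ => (0 : ℝ)) (by simp [h1])
  exact Finset.sum_pos' (fun j _ => mul_nonneg (h0 j) (hQ j a).le)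
    ⟨i, Finset.mem_univ i, mul_pos hi (hQ i a)⟩

theorem sum_mixedAction {mix : (I → A → ℝ) → I → ℝ} (hmix : IsMixingRule mix) (n : ℕ)
    (L : I → A → ℝ) : ∑ a, mixedAction mix n L a = 1 := by
  have hQ1 : ∀ i, ∑ a, proposals n L i a = 1 :=
    fun i => sum_tsallisPoint (regularizerWeight_succ_pos n) (L i)
  obtain ⟨-, h1⟩ := hmix (proposals n L)
    (fun i => tsallisPoint_pos (regularizerWeight_succ_pos n) (L i)) hQ1
  unfold mixedAction
  rw [Finset.sum_comm]
  simp only [← Finset.mul_sum, hQ1, mul_one, h1]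

/-- The bandit algorithm that mixes Tsallis learners. -/
noncomputable def mixedTsallis [DecidableEq A] {mix : (I → A → ℝ) → I → ℝ} (hmix : IsMixingRule mix) (B : ℝ) :
    BanditAlgorithm A := fun h =>
  PMF.ofFintype (fun a => ENNReal.ofReal (mixedAction mix h.length (estimatedLoss mix B h) a)) (by
    rw [← ENNReal.ofReal_sum_of_nonneg fun a _ => (mixedAction_pos hmix _ _ a).le,
      sum_mixedAction hmix, ENNReal.ofReal_one])

theorem mixedTsallis_apply [DecidableEq A] {mix : (I → A → ℝ) → I → ℝ} (hmix : IsMixingRule mix) (B : ℝ)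
    (h : List (A × ℝ)) (a : A) :
    (mixedTsallis hmix B h a).toReal = mixedAction mix h.length (estimatedLoss mix B h) a := by
  rw [mixedTsallis, PMF.ofFintype_apply, ENNReal.toReal_ofReal (mixedAction_pos hmix _ _ a).le]

/-- The weight `√n/√|I|` balances the variance term against the growth of the regulariser. Both are
then multiples of `√(|I||A|)` times an increment of `√n`, which telescopes. -/
theorem regularization_cost_le (A I : Type*) [Fintype A] [Fintype I] [Nonempty I] (n : ℕ) :
    √(Fintype.card A) / regularizerWeight I (n + 1)
      + Fintype.card I * (2 * (regularizerWeight I (n + 1) - regularizerWeight I n)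
        * √(Fintype.card A))
      ≤ 4 * √(Fintype.card I * Fintype.card A) * (√(n + 1 : ℕ) - √n) := by
  have hI : (0 : ℝ) < √(Fintype.card I) :=
    Real.sqrt_pos.2 (by exact_mod_cast Fintype.card_pos)
  have hI2 := Real.sq_sqrt (Nat.cast_nonneg (α := ℝ) (Fintype.card I))
  have hn : (0 : ℝ) < √(n + 1 : ℕ) := Real.sqrt_pos.2 (by positivity)
  have hd : 1 / √(n + 1 : ℕ) ≤ 2 * (√(n + 1 : ℕ) - √n) := by
    rw [div_le_iff₀ hn]
    have h1 := Real.sq_sqrt (Nat.cast_nonneg (α := ℝ) (n + 1))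
    have h2 := Real.sq_sqrt (Nat.cast_nonneg (α := ℝ) n)
    push_cast at h1 h2 ⊢
    nlinarith [sq_nonneg (√((n : ℝ) + 1) - √n)]
  unfold regularizerWeight
  rw [Real.sqrt_mul (Nat.cast_nonneg _)]
  set x := √(Fintype.card I : ℝ)
  set k := √(Fintype.card A : ℝ)
  have e : k / (√(n + 1 : ℕ) / x) + Fintype.card I * (2 * (√(n + 1 : ℕ) / x - √n / x) * k)
      = x * k * (1 / √(n + 1 : ℕ) + 2 * (√(n + 1 : ℕ) - √n)) := by
    rw [← hI2]
    field_simp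
  rw [e]
  have hxk : 0 ≤ x * k := mul_nonneg hI.le (Real.sqrt_nonneg _)
  nlinarith

theorem sub_eq_two_mul_loss_sub {B x y : ℝ} (hx : |x| ≤ B) (hy : |y| ≤ B) :
    x - y = 2 * B * ((B - y) / (2 * B) - (B - x) / (2 * B)) := by
  rcases eq_or_ne B 0 with rfl | hB
  · rw [abs_nonpos_iff.1 hx, abs_nonpos_iff.1 hy]
    simp
  · field_simp
    ring

/-- Learner `i` competes with the fixed action `e i`; `hdev` says that the weighted losses of these
competitors add up to the loss of the deviation. The constant 8 is 4 from `regularization_cost_le`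
times the width `2 * B` of the reward range. -/
theorem hasRegretPotential_mixedTsallis [DecidableEq A] {mix : (I → A → ℝ) → I → ℝ}
    (hmix : IsMixingRule mix) {B : ℝ} (hB : 0 ≤ B) (dev : A → A) (e : I → A)
    (hdev : ∀ (Q : I → A → ℝ) (l : A → ℝ), (∀ i a, 0 < Q i a) → (∀ i, ∑ a, Q i a = 1) →
      ∑ i, mix Q i * l (e i) = ∑ a, (∑ i, mix Q i * Q i a) * l (dev a)) :
    HasRegretPotential B (8 * B * √(Fintype.card I * Fintype.card A)) (mixedTsallis hmix B) dev := by
  let Est := estimatedLoss mix B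
  let c := 4 * √((Fintype.card I : ℝ) * Fintype.card A)
  -- The value carries the weight of `h.length` rounds, whereas the next action uses that of
  -- `h.length + 1`. The weight is therefore 0 on the empty history, where the value is nonnegative,
  -- and positive whenever an action is drawn.
  let Ψ : List (A × ℝ) → ℝ := fun h =>
    ∑ i, (Est h i (e i) - tsallisValue (regularizerWeight I h.length) (Est h i)) - c * √h.length
  refine ⟨fun h => 2 * B * Ψ h, ?_, fun h => ?_, fun h r hr => ?_⟩
  · have h0 : 0 ≤ tsallisValue (0 : ℝ) (0 : A → ℝ) :=
      le_ciInf fun q => by simp [tsallisObjective]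
    have : Ψ [] ≤ 0 := by
      simp only [Ψ, Est, estimatedLoss, regularizerWeight, List.length_nil, Nat.cast_zero,
        Real.sqrt_zero, zero_div, mul_zero, sub_zero, Pi.zero_apply, zero_sub]
      exact Finset.sum_nonpos fun i _ => neg_nonpos.2 h0
    exact mul_nonpos_of_nonneg_of_nonpos (by positivity) this
  · have h1 : 0 ≤ ∑ i, (Est h i (e i) - tsallisValue (regularizerWeight I h.length) (Est h i)) :=
      Finset.sum_nonneg fun i _ => sub_nonneg.2
        (tsallisValue_le_apply (div_nonneg (Real.sqrt_nonneg _) (Real.sqrt_nonneg _)) _ _)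
    have h2 := mul_nonneg (mul_nonneg zero_le_two hB) h1
    have h3 : 2 * B * Ψ h
        = 2 * B * ∑ i, (Est h i (e i) - tsallisValue (regularizerWeight I h.length) (Est h i))
          - 8 * B * √(Fintype.card I * Fintype.card A) * √h.length := by
      simp only [Ψ, c]
      ring
    linarith
  -- For `B = 0` division by zero makes every loss 0, so the bounds `0 ≤ l ≤ 1` still hold.
  · let l : A → ℝ := fun a => (B - r a) / (2 * B)
    let n := h.length
    let π := mix (proposals n (Est h))
    let p := mixedAction mix n (Est h)
    have hl0 : ∀ a, 0 ≤ l a := fun a =>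
      div_nonneg (by linarith [(abs_le.1 (hr a)).2]) (by positivity)
    have hl1 : ∀ a, l a ≤ 1 := fun a =>
      div_le_one_of_le₀ (by linarith [(abs_le.1 (hr a)).1]) (by positivity)
    have hQ : ∀ i a, 0 < proposals n (Est h) i a :=
      fun i => tsallisPoint_pos (regularizerWeight_succ_pos n) _
    have hQ1 : ∀ i, ∑ a, proposals n (Est h) i a = 1 :=
      fun i => sum_tsallisPoint (regularizerWeight_succ_pos n) _
    obtain ⟨hπ0, hπ1⟩ := hmix _ hQ hQ1
    have hp : ∀ a, 0 < p a := mixedAction_pos hmix n (Est h)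
    have hp1 : ∑ a, p a = 1 := sum_mixedAction hmix n (Est h)
    have hstep := le_sum_tsallisValue_add_estimate (regularizerWeight_succ_pos (I := I) n)
      (regularizerWeight_mono n) (Est h) hπ0 hπ1 hp (fun a => rfl) hl0 hl1
    have hcost := regularization_cost_le A I n
    have hd : ∑ i, π i * l (e i) = ∑ a, p a * l (dev a) := hdev _ l hQ hQ1
    have hest : ∀ a i, Est ((a, r a) :: h) i = Est h i + Pi.single a (π i * l a / p a) :=
      fun a i => rfl
    -- Importance weighting is unbiased: the factor `p a` cancels the denominator of the estimate.
    have hunbiased : ∑ a, p a * ∑ i, Pi.single (M := fun _ => ℝ) a (π i * l a / p a) (e i)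
        = ∑ i, π i * l (e i) := by
      simp only [Finset.mul_sum]
      rw [Finset.sum_comm]
      refine Finset.sum_congr rfl fun i _ => ?_
      rw [Finset.sum_eq_single (e i)]
      · rw [Pi.single_eq_same, mul_div_cancel₀ _ (hp _).ne']
      · intro a _ ha
        rw [Pi.single_eq_of_ne ha.symm, mul_zero]
      · simp
    have hΨ : ∀ a, Ψ ((a, r a) :: h) = ∑ i, Est h i (e i)
        + ∑ i, Pi.single (M := fun _ => ℝ) a (π i * l a / p a) (e i)
        - ∑ i, tsallisValue (regularizerWeight I (n + 1))
            (Est h i + Pi.single a (π i * l a / p a)) - c * √(n + 1 : ℕ) := by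
      intro a
      simp only [Ψ, hest, List.length_cons, Pi.add_apply, Finset.sum_sub_distrib,
        Finset.sum_add_distrib]
      rfl
    have hcalc : ∑ a, p a * (l a - l (dev a) + Ψ ((a, r a) :: h)) ≤ Ψ h := by
      have : ∑ a, p a * (l a - l (dev a) + Ψ ((a, r a) :: h))
          = ∑ a, p a * l a - ∑ a, p a * l (dev a) + (∑ i, Est h i (e i)
            + ∑ i, π i * l (e i)
            - ∑ a, p a * ∑ i, tsallisValue (regularizerWeight I (n + 1))
              (Est h i + Pi.single a (π i * l a / p a)) - c * √(n + 1 : ℕ)) := by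
        rw [← hunbiased]
        simp only [hΨ, mul_add, mul_sub, Finset.sum_add_distrib, Finset.sum_sub_distrib]
        simp only [← Finset.sum_mul, hp1, one_mul]
      rw [this, hd]
      have hΨh : Ψ h = ∑ i, Est h i (e i) - ∑ i, tsallisValue (regularizerWeight I n) (Est h i)
          - c * √n := by
        simp only [Ψ, Finset.sum_sub_distrib]
        rfl
      rw [hΨh]
      simp only [c]
      linarith
    calc ∑ a, (mixedTsallis hmix B h a).toReal
          * (r (dev a) - r a + 2 * B * Ψ ((a, r a) :: h))
        = 2 * B * ∑ a, p a * (l a - l (dev a) + Ψ ((a, r a) :: h)) := by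
          rw [Finset.mul_sum]
          refine Finset.sum_congr rfl fun a _ => ?_
          rw [mixedTsallis_apply, sub_eq_two_mul_loss_sub (hr (dev a)) (hr a)]
          simp only [p, l, Est, n]
          ring
      _ ≤ 2 * B * Ψ h := mul_le_mul_of_nonneg_left hcalc (by positivity)

end mixture

/-! ### The two algorithms and the main theorem. -/

/-- The weights of a stationary distribution of the matrix of the proposals. -/
noncomputable def stationaryMix {A : Type*} [Fintype A] (Q : A → A → ℝ) : A → ℝ :=
  open Classical in
  if h : ∃ p : A → ℝ, (∀ i, 0 ≤ p i) ∧ ∑ i, p i = 1 ∧ ∀ j, ∑ i, p i * Q i j = p j then h.choose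
  else 0

theorem stationaryMix_spec {A : Type*} [Fintype A] [Nonempty A] {Q : A → A → ℝ}
    (hQ : ∀ i j, 0 < Q i j) (hQ1 : ∀ i, ∑ j, Q i j = 1) :
    (∀ i, 0 ≤ stationaryMix Q i) ∧ ∑ i, stationaryMix Q i = 1 ∧
      ∀ j, ∑ i, stationaryMix Q i * Q i j = stationaryMix Q j := by
  have h := exists_stationary Q (fun i j => (hQ i j).le) hQ1
  rw [stationaryMix, dif_pos h]
  exact h.choose_spec

theorem exists_regret_algorithm (A : Type*) [Fintype A] [Nonempty A] {B : ℝ} (hB : 0 ≤ B) :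
    ∃ alg : BanditAlgorithm A,
      ∀ b : A, HasRegretPotential B (8 * B * √(Fintype.card A)) alg fun _ => b := by
  classical
  have hmix : IsMixingRule (fun (_ : Unit → A → ℝ) (_ : Unit) => (1 : ℝ)) :=
    fun Q _ _ => ⟨fun _ => zero_le_one, by simp⟩
  refine ⟨mixedTsallis hmix B, fun b => ?_⟩
  have h := hasRegretPotential_mixedTsallis hmix hB (fun _ => b) (fun _ => b) fun Q l _ hQ1 => by
    simp [← Finset.sum_mul, hQ1]
  simpa using h

/-- Stationarity makes the weight of learner `i` equal to the probability of playing `i`. Comparing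
learner `i` with `dev i` therefore measures swap-regret, and `|I| = |A|` turns `√(|I||A|)` into
`|A|`. -/
theorem exists_swap_regret_algorithm (A : Type*) [Fintype A] [Nonempty A] {B : ℝ} (hB : 0 ≤ B) :
    ∃ alg : BanditAlgorithm A,
      ∀ dev : A → A, HasRegretPotential B (8 * B * Fintype.card A) alg dev := by
  classical
  have hmix : IsMixingRule (stationaryMix (A := A)) :=
    fun Q hQ hQ1 => ⟨(stationaryMix_spec hQ hQ1).1, (stationaryMix_spec hQ hQ1).2.1⟩
  refine ⟨mixedTsallis hmix B, fun dev => ?_⟩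
  have h := hasRegretPotential_mixedTsallis hmix hB dev dev fun Q l hQ hQ1 => by
    simp only [(stationaryMix_spec hQ hQ1).2.2]
  rwa [Real.sqrt_mul_self (Nat.cast_nonneg _)] at h

theorem mainTheorem11 :
    ∃ C : ℝ, 0 < C ∧
      ∀ (A : Type*) [Fintype A] [Nonempty A] (B : ℝ), 0 ≤ B →
        (∃ alg : BanditAlgorithm A,
          BanditRegretLE B alg (fun T => C * B * √(Fintype.card A * T)) ∧
          ∀ (S : Type*) [Fintype S] [DecidableEq S] (X : Type*) (v : X → A → ℝ),
            (∀ x a, |v x a| ≤ B) →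
            ContextualRegretLE v (perContext alg S)
              (fun T => C * B * √(Fintype.card A * Fintype.card S * T))) ∧
        (∃ alg : BanditAlgorithm A,
          BanditSwapRegretLE B alg (fun T => C * B * (Fintype.card A * √T)) ∧
          ∀ (S : Type*) [Fintype S] [DecidableEq S] (X : Type*) (v : X → A → ℝ),
            (∀ x a, |v x a| ≤ B) →
            ContextualSwapRegretLE v (perContext alg S)
              (fun T => C * B * (Fintype.card A * √(Fintype.card S * T)))) := by
  refine ⟨8, by norm_num, fun A _ _ B hB => ⟨?_, ?_⟩⟩
  · obtain ⟨alg, H⟩ := exists_regret_algorithm A hB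
    refine ⟨alg, fun adv hadv T b => ?_, fun S _ _ X v hv σ T d => ?_⟩
    · beta_reduce
      rw [Real.sqrt_mul (Nat.cast_nonneg _), ← mul_assoc]
      exact (H b).bandit_regret_le adv hadv T
    · beta_reduce
      rw [mul_assoc (Fintype.card A : ℝ), Real.sqrt_mul (Nat.cast_nonneg _), ← mul_assoc]
      exact HasRegretPotential.contextual_regret_le (by positivity) hv (fun s => H (d s)) σ T
  · obtain ⟨alg, H⟩ := exists_swap_regret_algorithm A hB
    refine ⟨alg, fun adv hadv T d => ?_, fun S _ _ X v hv σ T d => ?_⟩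
    · beta_reduce
      rw [← mul_assoc]
      exact (H d).bandit_regret_le adv hadv T
    · beta_reduce
      rw [← mul_assoc]
      exact HasRegretPotential.contextual_regret_le (by positivity) hv
        (fun s => H fun a => d (s, a)) σ T
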